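/- A Banach Lie algebra is a complex Lie algebra $\mathcal L$ that is a Banach space and for which there is $t>0$ with $\|[a,b]\|\le t\|a\|\,\|b\|$ for all $a,b\in\mathcal L$. It is called Frattini-free if the intersection of all its maximal proper closed Lie subalgebras of finite codimension is $\{0\}$ (the intersection of the empty family being $\mathcal L$). For a Lie ideal $I$ of $\mathcal L$ put $I_{[0]}=I$ and let $I_{[n+1]}$ be the closed linear span of $\{[x,y]:x,y\in I_{[n]}\}$; $I$ is solvable if $I_{[n]}=\{0\}$ for some $n$, and commutative if $[x,y]=0$ for all $x,y\in I$. Corollary 9.11. Let $\mathcal L$ be a Frattini-free Banach Lie algebra. Then $\mathcal L$ has a largest solvable Lie ideal, and it is closed: there is a closed solvable Lie ideal $S$ of $\mathcal L$ that contains all solvable Lie ideals of $\mathcal L$, closed or not. Moreover, $[S,S]$ is commutative. Likewise, there is a closed commutative Lie ideal $K$ of $\mathcal L$ that contains all commutative Lie ideals of $\mathcal L$, closed or not. -/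

import Mathlib

/-- A Lie ring whose additive group carries a norm (one common additive structure). -/
class NormedLieRing (L : Type*) extends NormedAddCommGroup L, LieRing L

/-- A Banach Lie algebra: a complex Lie algebra that is a Banach space and whose bracket satisfies
`‖⁅a, b⁆‖ ≤ t * ‖a‖ * ‖b‖` for some multiplication constant `t > 0`. -/
class BanachLieAlgebra (L : Type*) [NormedLieRing L] extends
    NormedSpace ℂ L, LieAlgebra ℂ L, CompleteSpace L where
  exists_norm_lie_le : ∃ t : ℝ, 0 < t ∧ ∀ a b : L, ‖⁅a, b⁆‖ ≤ t * ‖a‖ * ‖b‖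

namespace BanachLieAlgebra

section

variable (L : Type*) [NormedLieRing L] [BanachLieAlgebra L]

/-- The maximal proper closed Lie subalgebras of finite codimension. -/
def maximalClosedSubalgebras : Set (LieSubalgebra ℂ L) :=
  {M | Maximal (fun N : LieSubalgebra ℂ L => IsClosed (N : Set L) ∧ N ≠ ⊤) M ∧
    FiniteDimensional ℂ (L ⧸ M.toSubmodule)}

/-- The intersection of all maximal proper closed Lie subalgebras of finite codimension
(the whole algebra if there are none). -/
def frattiniPreradical : LieSubalgebra ℂ L :=
  sInf (maximalClosedSubalgebras L)

/-- A Banach Lie algebra is Frattini-free if its maximal proper closed Lie subalgebras of finite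
codimension have zero intersection. -/
def IsFrattiniFree : Prop :=
  frattiniPreradical L = ⊥

end

section

variable {L : Type*} [NormedLieRing L] [BanachLieAlgebra L]

/-- The topological derived series of a subspace `I`: it starts at `I`, and each further term is the
closed linear span of all brackets of two elements of the term before. -/
def closedDerivedSeries (I : Submodule ℂ L) : ℕ → Submodule ℂ L
  | 0 => I
  | n + 1 => (Submodule.span ℂ {z : L | ∃ x ∈ closedDerivedSeries I n,
      ∃ y ∈ closedDerivedSeries I n, ⁅x, y⁆ = z}).topologicalClosure

/-- A Lie ideal, closed or not, is solvable if its topological derived series reaches zero. -/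
def IsSolvableIdeal (I : LieIdeal ℂ L) : Prop :=
  ∃ n : ℕ, closedDerivedSeries I.toSubmodule n = ⊥

end

end BanachLieAlgebra

/-! In a Frattini-free algebra an element is zero once it lies in every maximal subalgebra `M` of
finite codimension, so identities can be checked modulo `M`. If an ideal `A` is not inside `M` but
`[A, A]` is, then `L = M + A`, and maximality makes `A / (A ∩ M)` an irreducible `L`-module. For a
solvable ideal `I`, take `A` to be its last derived term outside `M`. By Lie's theorem `I` acts on
the quotient by scalars, so `[I, I]` acts by zero, which puts the second derived term of `I` in `M`,
hence equal to zero. The bound 2 does not depend on `I`, so it survives the union of all solvable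
ideals and, by continuity of the bracket, its closure. For commutative ideals, Schur-type reasoning
on the same quotient shows that any two of them commute, so their union is again commutative. -/

namespace LieSubalgebra

open LieAlgebra

/-! ### Maximal subalgebras and irreducible quotients -/

section CommRing

variable {R L : Type*} [CommRing R] [LieRing L] [LieAlgebra R L]

/-- A subspace normalised by a maximal subalgebra `M` whose brackets fall into the sum of both is
either contained in `M` or spans the whole algebra together with `M`. -/
theorem le_or_sup_eq_top_of_isCoatom {M : LieSubalgebra R L} (hM : IsCoatom M) (W : Submodule R L)
    (hMW : ∀ m ∈ M, ∀ w ∈ W, ⁅m, w⁆ ∈ W)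
    (hWW : ∀ w ∈ W, ∀ w' ∈ W, ⁅w, w'⁆ ∈ M.toSubmodule ⊔ W) :
    W ≤ M.toSubmodule ∨ M.toSubmodule ⊔ W = ⊤ := by
  let N : LieSubalgebra R L :=
    { M.toSubmodule ⊔ W with
      lie_mem' := by
        intro x y hx hy
        obtain ⟨m, hm, w, hw, rfl⟩ := Submodule.mem_sup.1 hx
        obtain ⟨m', hm', w', hw', rfl⟩ := Submodule.mem_sup.1 hy
        have h₁ : ⁅m, m'⁆ ∈ M.toSubmodule ⊔ W := Submodule.mem_sup_left (M.lie_mem hm hm')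
        have h₂ : ⁅m, w'⁆ ∈ M.toSubmodule ⊔ W := Submodule.mem_sup_right (hMW m hm w' hw')
        have h₃ : ⁅m', w⁆ ∈ M.toSubmodule ⊔ W := Submodule.mem_sup_right (hMW m' hm' w hw)
        have h : ⁅m + w, m' + w'⁆ = ⁅m, m'⁆ + ⁅m, w'⁆ - ⁅m', w⁆ + ⁅w, w'⁆ := by
          rw [add_lie, lie_add, lie_add, ← lie_skew w m']
          abel
        change ⁅m + w, m' + w'⁆ ∈ M.toSubmodule ⊔ W
        rw [h]
        exact add_mem (sub_mem (add_mem h₁ h₂) h₃) (hWW w hw w' hw') }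
  have hMN : M ≤ N := fun x hx => Submodule.mem_sup_left (T := W) hx
  rcases hM.le_iff.1 hMN with h | h
  · right
    exact congrArg LieSubalgebra.toSubmodule h
  · left
    intro w hw
    have : w ∈ N := Submodule.mem_sup_right hw
    rwa [h] at this

theorem exists_add_eq_of_isCoatom {M : LieSubalgebra R L} (hM : IsCoatom M) {A : LieIdeal R L}
    (hA : ¬ A.toSubmodule ≤ M.toSubmodule) (x : L) : ∃ m ∈ M, ∃ a ∈ A, m + a = x := by
  have h := (le_or_sup_eq_top_of_isCoatom hM A.toSubmodule
    (fun m _ a ha => lie_mem_right R L A m a ha)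
    (fun a _ b hb => Submodule.mem_sup_right (lie_mem_right R L A a b hb))).resolve_left hA
  exact Submodule.mem_sup.1 (h ▸ Submodule.mem_top : x ∈ M.toSubmodule ⊔ A.toSubmodule)

/-- The intersection of a maximal subalgebra with an ideal outside of it whose brackets lie in the
subalgebra is an ideal. -/
def infIdealOfIsCoatom {M : LieSubalgebra R L} (hM : IsCoatom M) (A : LieIdeal R L)
    (hA : ¬ A.toSubmodule ≤ M.toSubmodule) (hAA : ∀ a ∈ A, ∀ b ∈ A, ⁅a, b⁆ ∈ M) : LieIdeal R L :=
  { A.toSubmodule ⊓ M.toSubmodule with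
    lie_mem := by
      rintro x n ⟨hn, hn'⟩
      refine ⟨lie_mem_right R L A x n hn, ?_⟩
      obtain ⟨m, hm, a, ha, rfl⟩ := exists_add_eq_of_isCoatom hM hA x
      rw [add_lie]
      exact add_mem (M.lie_mem hm hn') (hAA a ha n hn) }

variable {M : LieSubalgebra R L} (hM : IsCoatom M) {A : LieIdeal R L}
  (hA : ¬ A.toSubmodule ≤ M.toSubmodule) (hAA : ∀ a ∈ A, ∀ b ∈ A, ⁅a, b⁆ ∈ M)

/-- The module `A / (A ∩ M)` over the ambient Lie algebra. -/
abbrev QuotInf : Type _ :=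
  A ⧸ LieSubmodule.comap (LieSubmodule.incl A) (infIdealOfIsCoatom hM A hA hAA)

theorem quotInf_mk_eq_zero {a : A} :
    (LieSubmodule.Quotient.mk a : QuotInf hM hA hAA) = 0 ↔ (a : L) ∈ M := by
  rw [LieSubmodule.Quotient.mk_eq_zero', LieSubmodule.mem_comap]
  exact ⟨fun h => h.2, fun h => ⟨a.2, h⟩⟩

/-- A submodule pulls back to an ideal `W'` inside `A`. By maximality of `M` it lies in `M`, giving
zero, or satisfies `M + W' = L`, giving everything. -/
theorem isIrreducible_quotInf : LieModule.IsIrreducible R L (QuotInf hM hA hAA) := by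
  have : Nontrivial (QuotInf hM hA hAA) := by
    obtain ⟨a, ha, haM⟩ := SetLike.not_le_iff_exists.1 hA
    refine ⟨⟨LieSubmodule.Quotient.mk (⟨a, ha⟩ : A), 0, fun h => haM ?_⟩⟩
    exact (quotInf_mk_eq_zero hM hA hAA).1 h
  refine LieModule.IsIrreducible.mk fun W hW => ?_
  let W' : Submodule R L := (W.comap (LieSubmodule.Quotient.mk' _)).toSubmodule.map
    A.toSubmodule.subtype
  have mem_W' : ∀ x, x ∈ W' ↔ ∃ h : x ∈ A,
      (LieSubmodule.Quotient.mk (⟨x, h⟩ : A) : QuotInf hM hA hAA) ∈ W := by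
    intro x
    constructor
    · rintro ⟨a, ha, rfl⟩
      exact ⟨a.2, ha⟩
    · rintro ⟨h, hx⟩
      exact ⟨⟨x, h⟩, hx, rfl⟩
  have hdich := le_or_sup_eq_top_of_isCoatom hM W'
    (by
      intro m _ w hw
      obtain ⟨h, hw⟩ := (mem_W' w).1 hw
      exact (mem_W' _).2 ⟨lie_mem_right R L A m w h, W.lie_mem (x := m) hw⟩)
    (by
      intro w hw w' hw'
      obtain ⟨h, -⟩ := (mem_W' w).1 hw
      obtain ⟨h', -⟩ := (mem_W' w').1 hw'
      exact Submodule.mem_sup_left (hAA w h w' h'))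
  rcases hdich with h | h
  · refine absurd ((LieSubmodule.eq_bot_iff W).2 fun v hv => ?_) hW
    obtain ⟨a, rfl⟩ := LieSubmodule.Quotient.surjective_mk' _ v
    exact (quotInf_mk_eq_zero hM hA hAA).2 (h ((mem_W' a).2 ⟨a.2, hv⟩))
  · refine eq_top_iff.2 fun v _ => ?_
    obtain ⟨a, rfl⟩ := LieSubmodule.Quotient.surjective_mk' _ v
    obtain ⟨m, hm, w, hw, e⟩ := Submodule.mem_sup.1
      (h ▸ Submodule.mem_top : (a : L) ∈ M.toSubmodule ⊔ W')
    obtain ⟨hwA, hw⟩ := (mem_W' w).1 hw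
    have hsub : (LieSubmodule.Quotient.mk (a - ⟨w, hwA⟩ : A) : QuotInf hM hA hAA) = 0 := by
      rw [quotInf_mk_eq_zero]
      have : ((a - ⟨w, hwA⟩ : A) : L) = m := sub_eq_of_eq_add e.symm
      rwa [this]
    have hmk : (LieSubmodule.Quotient.mk a : QuotInf hM hA hAA) =
        LieSubmodule.Quotient.mk (⟨w, hwA⟩ : A) :=
      sub_eq_zero.1 hsub
    change (LieSubmodule.Quotient.mk a : QuotInf hM hA hAA) ∈ W
    rwa [hmk]

end CommRing

/-! ### Solvable and commutative ideals modulo a maximal subalgebra -/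

section Field

variable {k L : Type*} [Field k] [LieRing L] [LieAlgebra k L]

theorem finiteDimensional_quotInf {M : LieSubalgebra k L} (hM : IsCoatom M)
    [FiniteDimensional k (L ⧸ M.toSubmodule)] {A : LieIdeal k L}
    (hA : ¬ A.toSubmodule ≤ M.toSubmodule) (hAA : ∀ a ∈ A, ∀ b ∈ A, ⁅a, b⁆ ∈ M) :
    FiniteDimensional k (QuotInf hM hA hAA) := by
  let f : A →ₗ[k] L ⧸ M.toSubmodule := M.toSubmodule.mkQ ∘ₗ A.toSubmodule.subtype
  have hf : (LieSubmodule.comap (LieSubmodule.incl A) (infIdealOfIsCoatom hM A hA hAA)).toSubmodule = LinearMap.ker f := by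
    ext a
    simp only [f, LinearMap.mem_ker, LinearMap.comp_apply, Submodule.mkQ_apply,
      Submodule.Quotient.mk_eq_zero]
    exact ⟨fun h => h.2, fun h => ⟨a.2, h⟩⟩
  let g : (A ⧸ LinearMap.ker f) ≃ₗ[k] LinearMap.range f := f.quotKerEquivRange
  have : FiniteDimensional k (A ⧸ (LieSubmodule.comap (LieSubmodule.incl A) (infIdealOfIsCoatom hM A hA hAA)).toSubmodule) := by
    rw [hf]
    exact g.symm.finiteDimensional
  exact this

/-- Brackets of a solvable ideal act trivially on irreducible finite-dimensional modules. -/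
theorem _root_.LieModule.lie_lie_eq_zero_of_isSolvable_of_isIrreducible [CharZero k] [IsAlgClosed k]
    (V : Type*) [AddCommGroup V] [Module k V] [LieRingModule L V] [LieModule k L V]
    [FiniteDimensional k V] [LieModule.IsIrreducible k L V]
    (I : LieIdeal k L) [LieAlgebra.IsSolvable I] {x y : L} (hx : x ∈ I) (hy : y ∈ I) (v : V) :
    ⁅⁅x, y⁆, v⁆ = 0 := by
  have := LieModule.nontrivial_of_isIrreducible k L V
  -- Lie's theorem for `I`: a nonzero weight space exists, and it is stable under all of `L`, so it
  -- is `V` and `I` acts by scalars.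
  obtain ⟨χ, hχ⟩ := LieModule.exists_nontrivial_weightSpace_of_isSolvable k I V
  let N : LieSubmodule k L V := LieModule.weightSpaceOfIsLieTower k V χ
  replace hχ : Nontrivial N := hχ
  have hN : N = ⊤ := N.eq_top_of_isIrreducible k L V
  have h : ∀ z ∈ I, ∃ c : k, ∀ v : V, ⁅z, v⁆ = c • v := fun z hz => ⟨χ ⟨z, hz⟩, fun v => by
    have hv : v ∈ N := hN ▸ LieSubmodule.mem_top v
    have hv' : ∀ (w : L) (hw : w ∈ I), ⁅w, v⁆ = χ ⟨w, hw⟩ • v := by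
      simpa [N, LieModule.weightSpaceOfIsLieTower, LieModule.mem_weightSpace] using hv
    exact hv' z hz⟩
  obtain ⟨c, hc⟩ := h x hx
  obtain ⟨d, hd⟩ := h y hy
  rw [lie_lie, hc, hd, hd, hc, smul_comm, sub_self]

variable {M : LieSubalgebra k L}

theorem derivedSeriesOfIdeal_two_le_of_isCoatom [CharZero k] [IsAlgClosed k] (hM : IsCoatom M)
    [FiniteDimensional k (L ⧸ M.toSubmodule)] (I : LieIdeal k L) [LieAlgebra.IsSolvable I] :
    (derivedSeriesOfIdeal k L 2 I).toSubmodule ≤ M.toSubmodule := by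
  obtain ⟨n, hn⟩ := LieAlgebra.IsSolvable.solvable k I
  rw [LieIdeal.derivedSeries_eq_bot_iff] at hn
  have hex : ∃ n, (derivedSeriesOfIdeal k L n I).toSubmodule ≤ M.toSubmodule := ⟨n, by simp [hn]⟩
  classical
  obtain ⟨p, hp⟩ | h0 : (∃ p, Nat.find hex = p + 1) ∨ Nat.find hex = 0 := by
    cases Nat.find hex <;> simp
  swap
  · exact le_trans (LieSubmodule.toSubmodule_le_toSubmodule _ _ |>.2 (derivedSeriesOfIdeal_le_self I 2))
      (by simpa [h0] using Nat.find_spec hex : I.toSubmodule ≤ M.toSubmodule)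
  -- The last derived term not contained in `M`; its derived term already lies in `M`.
  set A := derivedSeriesOfIdeal k L p I
  have hA : ¬ A.toSubmodule ≤ M.toSubmodule := Nat.find_min hex (by omega)
  have hAA : ∀ a ∈ A, ∀ b ∈ A, ⁅a, b⁆ ∈ M := by
    intro a ha b hb
    have := Nat.find_spec hex
    rw [hp, derivedSeriesOfIdeal_succ] at this
    exact this (LieSubmodule.lie_mem_lie ha hb)
  have := isIrreducible_quotInf hM hA hAA
  have := finiteDimensional_quotInf hM hA hAA
  have hI : ∀ x ∈ derivedSeriesOfIdeal k L 1 I, ∀ a ∈ A, ⁅x, a⁆ ∈ M := by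
    intro x hx a ha
    rw [derivedSeriesOfIdeal_succ, derivedSeriesOfIdeal_zero, ← LieSubmodule.mem_toSubmodule,
      LieSubmodule.lieIdeal_oper_eq_linear_span'] at hx
    induction hx using Submodule.span_induction with
    | mem x hx =>
      obtain ⟨y, hy, z, hz, rfl⟩ := hx
      exact (quotInf_mk_eq_zero hM hA hAA (a := ⁅⁅y, z⁆, (⟨a, ha⟩ : A)⁆)).1
        (LieModule.lie_lie_eq_zero_of_isSolvable_of_isIrreducible (QuotInf hM hA hAA) I hy hz
          (LieSubmodule.Quotient.mk ⟨a, ha⟩))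
    | zero => simp
    | add x y _ _ hx hy => rw [add_lie]; exact add_mem hx hy
    | smul c x _ hx => rw [smul_lie]; exact M.smul_mem c hx
  rw [derivedSeriesOfIdeal_succ, LieSubmodule.lieIdeal_oper_eq_linear_span', Submodule.span_le]
  rintro _ ⟨x, hx, y, hy, rfl⟩
  obtain ⟨m, hm, a, ha, rfl⟩ := exists_add_eq_of_isCoatom hM hA x
  obtain ⟨m', hm', a', ha', rfl⟩ := exists_add_eq_of_isCoatom hM hA y
  -- Each term is in `M`: the middle two because `m + a` and `m' + a'` lie in `[I, I]`, the last
  -- because `[A, A]` is in `M`.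
  have h : ⁅m + a, m' + a'⁆ = ⁅m, m'⁆ + ⁅m + a, a'⁆ - ⁅m' + a', a⁆ + ⁅a', a⁆ := by
    simp only [add_lie, lie_add]
    rw [← lie_skew a m', ← lie_skew a a']
    abel
  rw [h]
  exact add_mem (sub_mem (add_mem (M.lie_mem hm hm') (hI _ hx a' ha')) (hI _ hy a ha))
    (hAA a' ha' a ha)

theorem lie_mem_of_isCoatom_of_isLieAbelian (hM : IsCoatom M) (I J : LieIdeal k L)
    [IsLieAbelian I] [IsLieAbelian J] {x y : L} (hx : x ∈ I) (hy : y ∈ J) : ⁅x, y⁆ ∈ M := by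
  by_cases hJ : J.toSubmodule ≤ M.toSubmodule
  · exact hJ (lie_mem_right k L J x y hy)
  have hII : ∀ a ∈ I, ∀ b ∈ I, ⁅a, b⁆ = 0 := fun a ha b hb =>
    congrArg Subtype.val (trivial_lie_zero I I ⟨a, ha⟩ ⟨b, hb⟩)
  have hJJ : ∀ a ∈ J, ∀ b ∈ J, ⁅a, b⁆ = 0 := fun a ha b hb =>
    congrArg Subtype.val (trivial_lie_zero J J ⟨a, ha⟩ ⟨b, hb⟩)
  have hJM : ∀ a ∈ J, ∀ b ∈ J, ⁅a, b⁆ ∈ M := fun a ha b hb => hJJ a ha b hb ▸ M.zero_mem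
  have := isIrreducible_quotInf hM hJ hJM
  let V := QuotInf hM hJ hJM
  -- The vectors killed by `I`: by irreducibility none but zero, or all. Since `[I, J]` lies in the
  -- abelian `I`, its image is in `W`, so it vanishes in either case.
  let W : LieSubmodule k L V :=
    { carrier := {v | ∀ a ∈ I, ⁅a, v⁆ = 0}
      add_mem' := fun {v w} hv hw a ha => by rw [lie_add, hv a ha, hw a ha, add_zero]
      zero_mem' := fun a _ => lie_zero a
      smul_mem' := fun c v hv a ha => by rw [lie_smul, hv a ha, smul_zero]
      lie_mem := fun {z v} hv a ha => by
        change ⁅a, ⁅z, v⁆⁆ = 0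
        rw [leibniz_lie, hv a ha, lie_zero, hv _ (lie_mem_left k L I a z ha), add_zero] }
  have mem_W : ∀ v, v ∈ W ↔ ∀ a ∈ I, ⁅a, v⁆ = 0 := fun _ => Iff.rfl
  have key : ∀ (b : J), (LieSubmodule.Quotient.mk ⁅x, b⁆ : V) ∈ W := by
    intro b
    rw [mem_W]
    intro a ha
    have h0 : ⁅a, ⁅x, b⁆⁆ = 0 :=
      Subtype.ext (hII a ha _ (lie_mem_left k L I x b hx))
    change (LieSubmodule.Quotient.mk ⁅a, ⁅x, b⁆⁆ : V) = 0
    rw [h0]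
    rfl
  have hxy : (LieSubmodule.Quotient.mk ⁅x, (⟨y, hy⟩ : J)⁆ : V) = 0 := by
    rcases eq_or_ne W ⊥ with h | h
    · exact (LieSubmodule.mem_bot _).1 (h ▸ key ⟨y, hy⟩)
    · have hW : W = ⊤ := by
        have := (LieSubmodule.nontrivial_iff_ne_bot k L V).2 h
        exact W.eq_top_of_isIrreducible k L V
      exact (mem_W (LieSubmodule.Quotient.mk ⟨y, hy⟩)).1 (hW ▸ LieSubmodule.mem_top _) x hx
  exact (quotInf_mk_eq_zero hM hJ hJM (a := ⁅x, (⟨y, hy⟩ : J)⁆)).1 hxy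

end Field

end LieSubalgebra

/-! ### Unions of ideals and the second derived term -/

namespace LieIdeal

variable {R L : Type*} [CommRing R] [LieRing L] [LieAlgebra R L]

theorem exists_mem_iff_of_sup_mem (P : LieIdeal R L → Prop) (hbot : P ⊥)
    (hsup : ∀ I J, P I → P J → P (I ⊔ J)) :
    ∃ U : LieIdeal R L, ∀ x, x ∈ U ↔ ∃ I, P I ∧ x ∈ I :=
  ⟨{  carrier := {x | ∃ I, P I ∧ x ∈ I}
      add_mem' := by
        rintro x y ⟨I, hI, hx⟩ ⟨J, hJ, hy⟩
        exact ⟨I ⊔ J, hsup I J hI hJ, add_mem ((le_sup_left : I ≤ I ⊔ J) hx)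
          ((le_sup_right : J ≤ I ⊔ J) hy)⟩
      zero_mem' := ⟨⊥, hbot, zero_mem _⟩
      smul_mem' := by
        rintro c x ⟨I, hI, hx⟩
        exact ⟨I, hI, I.smul_mem c hx⟩
      lie_mem := by
        rintro x m ⟨I, hI, hm⟩
        exact ⟨I, hI, I.lie_mem hm⟩ }, fun _ => Iff.rfl⟩

theorem derivedSeriesOfIdeal_two_eq_bot_iff (I : LieIdeal R L) :
    LieAlgebra.derivedSeriesOfIdeal R L 2 I = ⊥ ↔
      ∀ a ∈ I, ∀ b ∈ I, ∀ c ∈ I, ∀ d ∈ I, ⁅⁅a, b⁆, ⁅c, d⁆⁆ = 0 := by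
  rw [eq_bot_iff, LieAlgebra.derivedSeriesOfIdeal_succ, LieAlgebra.derivedSeriesOfIdeal_succ,
    LieAlgebra.derivedSeriesOfIdeal_zero, LieSubmodule.lie_le_iff]
  constructor
  · intro h a ha b hb c hc d hd
    exact (LieSubmodule.mem_bot _).1
      (h _ (LieSubmodule.lie_mem_lie ha hb) _ (LieSubmodule.lie_mem_lie hc hd))
  · intro h x hx y hy
    rw [LieSubmodule.mem_bot]
    rw [← LieSubmodule.mem_toSubmodule, LieSubmodule.lieIdeal_oper_eq_linear_span'] at hx hy
    induction hx, hy using Submodule.span_induction₂ with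
    | mem_mem x y hx hy =>
      obtain ⟨a, ha, b, hb, rfl⟩ := hx
      obtain ⟨c, hc, d, hd, rfl⟩ := hy
      exact h a ha b hb c hc d hd
    | zero_left y _ => exact zero_lie y
    | zero_right x _ => exact lie_zero x
    | add_left x y z _ _ _ h₁ h₂ => rw [add_lie, h₁, h₂, add_zero]
    | add_right x y z _ _ _ h₁ h₂ => rw [lie_add, h₁, h₂, add_zero]
    | smul_left r x y _ _ h => rw [smul_lie, h, smul_zero]
    | smul_right r x y _ _ h => rw [lie_smul, h, smul_zero]

end LieIdeal

/-! ### Closures and the Frattini-free case -/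

namespace BanachLieAlgebra

open LieAlgebra

variable {L : Type*} [NormedLieRing L] [BanachLieAlgebra L]

theorem continuous_lie : Continuous fun p : L × L => ⁅p.1, p.2⁆ := by
  obtain ⟨t, -, ht⟩ := exists_norm_lie_le (L := L)
  exact ((LieModule.toEnd ℂ L L : L →ₗ[ℂ] L →ₗ[ℂ] L).mkContinuous₂ t ht).continuous₂

theorem lie_mem_closure {s t u : Set L} (h : ∀ x ∈ s, ∀ y ∈ t, ⁅x, y⁆ ∈ u) {x y : L}
    (hx : x ∈ closure s) (hy : y ∈ closure t) : ⁅x, y⁆ ∈ closure u :=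
  map_mem_closure₂ continuous_lie hx hy h

/-- The closure of a Lie ideal. -/
def idealClosure (I : LieIdeal ℂ L) : LieIdeal ℂ L :=
  { I.toSubmodule.topologicalClosure with
    lie_mem := fun {x _} hm =>
      lie_mem_closure (s := Set.univ) (fun x _ y hy => lie_mem_right ℂ L I x y hy)
        (subset_closure (Set.mem_univ x)) hm }

theorem lie_mem_closure_of_mem_idealClosure {I : LieIdeal ℂ L} {u : Set L}
    (h : ∀ x ∈ I, ∀ y ∈ I, ⁅x, y⁆ ∈ u) {x y : L} (hx : x ∈ idealClosure I)
    (hy : y ∈ idealClosure I) : ⁅x, y⁆ ∈ closure u :=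
  lie_mem_closure (s := (I : Set L)) (t := (I : Set L)) h hx hy

theorem isClosed_idealClosure (I : LieIdeal ℂ L) : IsClosed (idealClosure I : Set L) :=
  isClosed_closure

theorem le_idealClosure (I : LieIdeal ℂ L) : I ≤ idealClosure I :=
  fun _ hx => subset_closure (s := (I : Set L)) hx

theorem derivedSeriesOfIdeal_le_closedDerivedSeries (I : LieIdeal ℂ L) (n : ℕ) :
    (derivedSeriesOfIdeal ℂ L n I).toSubmodule ≤ closedDerivedSeries I.toSubmodule n := by
  induction n with
  | zero => exact le_rfl
  | succ n ih =>
    rw [derivedSeriesOfIdeal_succ, LieSubmodule.lieIdeal_oper_eq_linear_span']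
    refine le_trans (Submodule.span_mono ?_) (Submodule.le_topologicalClosure _)
    rintro _ ⟨x, hx, y, hy, rfl⟩
    exact ⟨x, ih hx, y, ih hy, rfl⟩

theorem closedDerivedSeries_le_closure_derivedSeriesOfIdeal (I : LieIdeal ℂ L) (n : ℕ) :
    closedDerivedSeries I.toSubmodule n ≤
      (derivedSeriesOfIdeal ℂ L n I).toSubmodule.topologicalClosure := by
  induction n with
  | zero => exact Submodule.le_topologicalClosure _
  | succ n ih =>
    refine Submodule.topologicalClosure_minimal _ (Submodule.span_le.2 ?_)
      (Submodule.isClosed_topologicalClosure _)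
    rintro _ ⟨x, hx, y, hy, rfl⟩
    refine lie_mem_closure (fun x hx y hy => ?_) (ih hx) (ih hy)
    rw [derivedSeriesOfIdeal_succ]
    exact LieSubmodule.lie_mem_lie hx hy

/-- Each closed derived term lies between the algebraic one and its closure, and `{0}` is closed. -/
theorem isSolvableIdeal_iff {I : LieIdeal ℂ L} :
    IsSolvableIdeal I ↔ LieAlgebra.IsSolvable I := by
  rw [LieAlgebra.isSolvable_iff (R := ℂ)]
  refine exists_congr fun n => ?_
  rw [LieIdeal.derivedSeries_eq_bot_iff]
  constructor
  · intro h
    have := derivedSeriesOfIdeal_le_closedDerivedSeries I n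
    rwa [h, le_bot_iff, LieSubmodule.toSubmodule_eq_bot] at this
  · intro h
    have := closedDerivedSeries_le_closure_derivedSeriesOfIdeal I n
    rwa [h, LieSubmodule.bot_toSubmodule,
      (isClosed_singleton (x := (0 : L))).submodule_topologicalClosure_eq (s := ⊥),
      le_bot_iff] at this

/-- Any subspace containing a closed one of finite codimension is closed, so maximality among closed
subalgebras is maximality among all. -/
theorem isCoatom_of_mem_maximalClosedSubalgebras {M : LieSubalgebra ℂ L}
    (hM : M ∈ maximalClosedSubalgebras L) : IsCoatom M := by
  obtain ⟨⟨⟨hcl, hne⟩, hmax⟩, hfin⟩ := hM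
  refine ⟨hne, fun N hMN => ?_⟩
  by_contra hN
  have hcl' : IsClosed (N : Set L) :=
    Submodule.isClosed_mono_of_finiteDimensional_quotient hcl hMN.le
  exact hMN.not_ge (hmax ⟨hcl', hN⟩ hMN.le)

theorem eq_zero_of_forall_mem (hL : IsFrattiniFree L) {x : L}
    (hx : ∀ M : LieSubalgebra ℂ L, IsCoatom M → FiniteDimensional ℂ (L ⧸ M.toSubmodule) → x ∈ M) :
    x = 0 := by
  have : x ∈ frattiniPreradical L := by
    rw [frattiniPreradical, ← SetLike.mem_coe, LieSubalgebra.coe_sInf, Set.mem_iInter₂]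
    exact fun M hM => hx M (isCoatom_of_mem_maximalClosedSubalgebras hM) hM.2
  rw [hL] at this
  exact (LieSubalgebra.mem_bot x).1 this

theorem derivedSeriesOfIdeal_two_eq_bot (hL : IsFrattiniFree L) (I : LieIdeal ℂ L)
    [LieAlgebra.IsSolvable I] : derivedSeriesOfIdeal ℂ L 2 I = ⊥ :=
  (LieSubmodule.eq_bot_iff _).2 fun _ hx => eq_zero_of_forall_mem hL fun _ hM _ =>
    LieSubalgebra.derivedSeriesOfIdeal_two_le_of_isCoatom hM I hx

theorem exists_isGreatest_isSolvableIdeal (hL : IsFrattiniFree L) :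
    ∃ S : LieIdeal ℂ L, IsClosed (S : Set L) ∧
      IsGreatest {I : LieIdeal ℂ L | IsSolvableIdeal I} S ∧
      IsLieAbelian (⁅S, S⁆ : LieIdeal ℂ L) := by
  obtain ⟨U, hU⟩ := LieIdeal.exists_mem_iff_of_sup_mem
    (fun I : LieIdeal ℂ L => LieAlgebra.IsSolvable I) inferInstance
    (fun I J _ _ => LieAlgebra.isSolvableAdd (R := ℂ) (I := I) (J := J))
  have hUU : ∀ a ∈ U, ∀ b ∈ U, ∀ c ∈ U, ∀ d ∈ U, ⁅⁅a, b⁆, ⁅c, d⁆⁆ = 0 := by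
    intro a ha b hb c hc d hd
    obtain ⟨I₁, h₁, ha⟩ := (hU a).1 ha
    obtain ⟨I₂, h₂, hb⟩ := (hU b).1 hb
    obtain ⟨I₃, h₃, hc⟩ := (hU c).1 hc
    obtain ⟨I₄, h₄, hd⟩ := (hU d).1 hd
    -- Four elements of the union lie in one solvable ideal, where the uniform bound 2 applies.
    have : LieAlgebra.IsSolvable ((I₁ + I₂) + (I₃ + I₄) : LieIdeal ℂ L) := inferInstance
    have hle₁ : I₁ + I₂ ≤ (I₁ + I₂) + (I₃ + I₄) := le_sup_left
    have hle₂ : I₃ + I₄ ≤ (I₁ + I₂) + (I₃ + I₄) := le_sup_right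
    exact (LieIdeal.derivedSeriesOfIdeal_two_eq_bot_iff _).1
      (derivedSeriesOfIdeal_two_eq_bot hL ((I₁ + I₂) + (I₃ + I₄)))
      a (hle₁ ((le_sup_left : I₁ ≤ I₁ ⊔ I₂) ha)) b (hle₁ ((le_sup_right : I₂ ≤ I₁ ⊔ I₂) hb))
      c (hle₂ ((le_sup_left : I₃ ≤ I₃ ⊔ I₄) hc)) d (hle₂ ((le_sup_right : I₄ ≤ I₃ ⊔ I₄) hd))
  have hS : derivedSeriesOfIdeal ℂ L 2 (idealClosure U) = ⊥ := by
    rw [LieIdeal.derivedSeriesOfIdeal_two_eq_bot_iff]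
    intro a ha b hb c hc d hd
    have hbr : ∀ x ∈ idealClosure U, ∀ y ∈ idealClosure U,
        ⁅x, y⁆ ∈ closure {z : L | ∃ x ∈ U, ∃ y ∈ U, ⁅x, y⁆ = z} := by
      intro x hx y hy
      refine lie_mem_closure_of_mem_idealClosure (fun x hx y hy => ?_) hx hy
      exact ⟨x, hx, y, hy, rfl⟩
    have h0 : ⁅⁅a, b⁆, ⁅c, d⁆⁆ ∈ closure ({0} : Set L) := by
      refine lie_mem_closure (fun x hx y hy => ?_) (hbr a ha b hb) (hbr c hc d hd)
      obtain ⟨a, ha, b, hb, rfl⟩ := hx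
      obtain ⟨c, hc, d, hd, rfl⟩ := hy
      exact hUU a ha b hb c hc d hd
    simpa using h0
  refine ⟨idealClosure U, isClosed_idealClosure U, ⟨?_, fun I hI x hx => ?_⟩, ?_⟩
  · exact isSolvableIdeal_iff.2
      (LieAlgebra.IsSolvable.mk ((LieIdeal.derivedSeries_eq_bot_iff _ 2).2 hS))
  · exact le_idealClosure U ((hU x).2 ⟨I, isSolvableIdeal_iff.1 hI, hx⟩)
  · exact (abelian_iff_derived_succ_eq_bot (idealClosure U) 1).2 hS

theorem isLieAbelian_iff {I : LieIdeal ℂ L} :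
    IsLieAbelian I ↔ ∀ x ∈ I, ∀ y ∈ I, ⁅x, y⁆ = 0 :=
  ⟨fun _ x hx y hy => congrArg Subtype.val (trivial_lie_zero I I ⟨x, hx⟩ ⟨y, hy⟩),
    fun h => ⟨fun x y => Subtype.ext (h x x.2 y y.2)⟩⟩

theorem exists_isGreatest_isLieAbelian (hL : IsFrattiniFree L) :
    ∃ K : LieIdeal ℂ L, IsClosed (K : Set L) ∧
      IsGreatest {I : LieIdeal ℂ L | IsLieAbelian I} K := by
  have hIJ : ∀ I J : LieIdeal ℂ L, IsLieAbelian I → IsLieAbelian J →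
      ∀ x ∈ I, ∀ y ∈ J, ⁅x, y⁆ = 0 := fun I J _ _ x hx y hy =>
    eq_zero_of_forall_mem hL fun _ hM _ =>
      LieSubalgebra.lie_mem_of_isCoatom_of_isLieAbelian hM I J hx hy
  obtain ⟨U, hU⟩ := LieIdeal.exists_mem_iff_of_sup_mem
    (fun I : LieIdeal ℂ L => IsLieAbelian I) inferInstance (by
      intro I J hI hJ
      rw [isLieAbelian_iff]
      intro x hx y hy
      obtain ⟨a, ha, b, hb, rfl⟩ := (LieSubmodule.mem_sup _ _ _).1 hx
      obtain ⟨c, hc, d, hd, rfl⟩ := (LieSubmodule.mem_sup _ _ _).1 hy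
      rw [add_lie, lie_add, lie_add, hIJ I I hI hI a ha c hc, hIJ I J hI hJ a ha d hd,
        hIJ J I hJ hI b hb c hc, hIJ J J hJ hJ b hb d hd]
      simp)
  refine ⟨idealClosure U, isClosed_idealClosure U, ?_, fun I hI x hx => ?_⟩
  · refine isLieAbelian_iff.2 fun x hx y hy => ?_
    have h0 : ⁅x, y⁆ ∈ closure ({0} : Set L) := by
      refine lie_mem_closure_of_mem_idealClosure (fun x hx y hy => ?_) hx hy
      obtain ⟨I, hI, hx⟩ := (hU x).1 hx
      obtain ⟨J, hJ, hy⟩ := (hU y).1 hy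
      exact hIJ I J hI hJ x hx y hy
    simpa using h0
  · exact le_idealClosure U ((hU x).2 ⟨I, hI, hx⟩)

end BanachLieAlgebra

theorem corollary9p11 (L : Type*) [NormedLieRing L] [BanachLieAlgebra L]
    (hL : BanachLieAlgebra.IsFrattiniFree L) :
    (∃ S : LieIdeal ℂ L, IsClosed (S : Set L) ∧
      IsGreatest {I : LieIdeal ℂ L | BanachLieAlgebra.IsSolvableIdeal I} S ∧
      IsLieAbelian (⁅S, S⁆ : LieIdeal ℂ L)) ∧
    (∃ K : LieIdeal ℂ L, IsClosed (K : Set L) ∧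
      IsGreatest {I : LieIdeal ℂ L | IsLieAbelian I} K) :=
  ⟨BanachLieAlgebra.exists_isGreatest_isSolvableIdeal hL,
    BanachLieAlgebra.exists_isGreatest_isLieAbelian hL⟩
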